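/- **Theorem (vectorial measure associated with an integrable $G$-valued form).** Let $\mathbb K\in\{\mathbb R,\mathbb C\}$, let $G$ be a Hausdorff locally convex space over $\mathbb K$, let $G'$ be its topological dual and let $(G')^*$ be the algebraic dual of $G'$. Let $M$ be an oriented smooth manifold (Hausdorff and $\sigma$-compact), with or without boundary, of finite dimension $N\ge 1$; let $\mathcal A(M)$ be the algebra of smooth functions $M\to\mathbb R$, and let $\lambda$ be the Lebesgue measure on $\mathbb R^N$. *Forms.* Let $\mathfrak L^1_c(M,G,\lambda)$ be the $\mathcal A(M)$-module of the maps $f:M\to G$ with compact support such that, for every chart $(U,\phi)$ of $M$ and every $\psi\in G'$, the function $\psi\circ f\circ\phi^{-1}$ is locally $\lambda$-integrable on $\phi(U)$ (that is, integrable on a neighbourhood in $\phi(U)$ of each point of $\phi(U)$). Let $\mathrm{Alt}^N(M)$ be the $\mathcal A(M)$-module of alternating $\mathcal A(M)$-multilinear maps $\Gamma(TM)^N\to\mathcal A(M)$, where $\Gamma(TM)$ is the module of smooth vector fields; its elements are identified with the smooth $N$-forms on $M$. Put $$\mathrm{Alt}^N(M;G,\lambda)=\mathfrak L^1_c(M,G,\lambda)\otimes_{\mathcal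 A(M)}\mathrm{Alt}^N(M).$$ For a continuous compactly supported $g:M\to\mathbb R$ let $\eta\mapsto g\cdot\eta$ be the $\mathcal A(M)$-linear endomorphism of $\mathrm{Alt}^N(M;G,\lambda)$ with $g\cdot(f\otimes T)=(gf)\otimes T$; for $\psi\in G'$ let $\psi_\times:\mathrm{Alt}^N(M;G,\lambda)\to\mathrm{Alt}^N(M;\mathbb K,\lambda)$ be the $\mathcal A(M)$-linear map with $\psi_\times(f\otimes T)=(\psi\circ f)\otimes T$. *Integral.* The support of a form is the closure of the set of points at which its value is nonzero. If $\omega\in\mathrm{Alt}^N(M;\mathbb R,\lambda)$, take finitely many charts $(U_\alpha,\phi_\alpha)_{\alpha\in D}$, each positively or negatively oriented, whose domains cover $\mathrm{supp}\,\omega$, and a smooth partition of unity $(\psi_\alpha)_{\alpha\in D\cup\{\dagger\}}$ on $M$ subordinate to the covering by the $U_\alpha$ and $U_\dagger=M\setminus\mathrm{supp}\,\omega$; then $$\int\omega=\sum_{\alpha\in D}\gamma_\alpha\int_{\phi_\alpha(U_\alpha)}h_\alpha\,d\lambda,\qquad (\phi_\alpha^{-1})^*(\psi_\alpha\omega)=h_\alpha\,dx_1\wedge\dots\wedge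 dx_N,$$ where $\gamma_\alpha=1$ if $\phi_\alpha$ is positively oriented and $\gamma_\alpha=-1$ otherwise; the result does not depend on the choices. If $\omega\in\mathrm{Alt}^N(M;\mathbb C,\lambda)$, then $\int\omega=\int\mathrm{Re}\,\omega+i\int\mathrm{Im}\,\omega$. The weak integral of $\eta\in\mathrm{Alt}^N(M;G,\lambda)$ is the map $\int\eta:G'\to\mathbb K$, $\psi\mapsto\int\psi_\times(\eta)$; it is an element of $(G')^*$. *Measures.* Let $\mathcal H(M)$ be the space of compactly supported continuous functions $M\to\mathbb R$ with its usual locally convex inductive limit topology (the finest locally convex topology that makes continuous the inclusions of the subspaces of functions supported in a fixed compact set, with uniform convergence). Let $G^\star$ be the real locally convex space underlying $(G')^*$ with the weak topology $\sigma((G')^*,G')$, and let $\mathrm{Meas}(M,G^\star)$ be the real vector space of continuous $\mathbb R$-linear maps $\mathcal H(M)\to G^\star$. *Claim.* There is a unique $\mathbb R$-linear map $\mathfrak m:\mathrm{Alt}^N(M;G,\lambda)\to\mathrm{Meas}(M,G^\star)$, $\eta\mapsto\mathfrak m_\eta$, such that $$\mathfrak m_\eta(g)=\int g\cdot\eta\qquad\text{for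 every }\eta\in\mathrm{Alt}^N(M;G,\lambda)\text{ and every }g\in\mathcal H(M).$$ -/

import Mathlib

open MeasureTheory Set Function Manifold
open scoped ContDiff Manifold TensorProduct CompactlySupported

noncomputable section

namespace IntegrableForm

/-! ### Smooth functions, vector fields, smooth alternating forms -/

section Basic

variable {N : ℕ} {H : Type*} [TopologicalSpace H]
  (I : ModelWithCorners ℝ (EuclideanSpace ℝ (Fin N)) H)
  (M : Type*) [TopologicalSpace M] [ChartedSpace H M]

/-- The algebra `𝒜(M)` of real valued smooth functions on `M`. -/
abbrev SmoothFun := C^∞⟮I, M; 𝓘(ℝ, ℝ), ℝ⟯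

/-- `𝒜(M)` acts on the maps `M → V`, for `V` a real vector space, by pointwise multiplication. -/
instance instModuleFun {V : Type*} [AddCommGroup V] [Module ℝ V] :
    Module (SmoothFun I M) (M → V) where
  smul a f := fun p => a p • f p
  one_smul f := by funext p; exact one_smul ℝ (f p)
  mul_smul a b f := by funext p; exact mul_smul (a p) (b p) (f p)
  smul_zero a := by funext p; exact smul_zero (a p)
  smul_add a f g := by funext p; exact smul_add (a p) (f p) (g p)
  add_smul a b f := by funext p; exact add_smul (a p) (b p) (f p)
  zero_smul f := by funext p; exact zero_smul ℝ (f p)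

theorem smoothFun_smul_apply {V : Type*} [AddCommGroup V] [Module ℝ V]
    (a : SmoothFun I M) (f : M → V) (p : M) : (a • f) p = a p • f p := rfl

instance instIsScalarTowerFun {V : Type*} [AddCommGroup V] [Module ℝ V] :
    IsScalarTower ℝ (SmoothFun I M) (M → V) where
  smul_assoc c a f := by funext p; exact mul_smul c (a p) (f p)

variable [IsManifold I ∞ M]

/-- The smooth vector fields `Γ(TM)` on `M`. -/
abbrev VField := Cₛ^∞⟮I; EuclideanSpace ℝ (Fin N), (TangentSpace I : M → Type _)⟯

instance instSMulVField : SMul (SmoothFun I M) (VField I M) where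
  smul a X := ⟨fun p => a p • X p, a.contMDiff.smul_section X.contMDiff⟩

theorem vfield_smul_apply (a : SmoothFun I M) (X : VField I M) (p : M) :
    (a • X) p = a p • X p := rfl

instance instModuleVField : Module (SmoothFun I M) (VField I M) where
  one_smul X := by ext1 p; exact one_smul ℝ (X p)
  mul_smul a b X := by ext1 p; exact mul_smul (a p) (b p) (X p)
  smul_zero a := by ext1 p; exact smul_zero (a p)
  smul_add a X Y := by ext1 p; exact smul_add (a p) (X p) (Y p)
  add_smul a b X := by ext1 p; exact add_smul (a p) (b p) (X p)
  zero_smul X := by ext1 p; exact zero_smul ℝ (X p)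

/-- `Alt^N(M)`: the `𝒜(M)`-module of alternating `𝒜(M)`-multilinear maps `Γ(TM)^N → 𝒜(M)`,
where `N = dim M`. -/
abbrev AltTop := (VField I M) [⋀^Fin N]→ₗ[SmoothFun I M] (SmoothFun I M)

end Basic

section Value

variable {N : ℕ} {H : Type*} [TopologicalSpace H]
  {I : ModelWithCorners ℝ (EuclideanSpace ℝ (Fin N)) H}
  {M : Type*} [TopologicalSpace M] [ChartedSpace H M] [IsManifold I ∞ M] [T2Space M]

/-- Every tangent vector is the value of a global smooth vector field. -/
theorem exists_vfield (p : M) (v : TangentSpace I p) : ∃ X : VField I M, X p = v := by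
  obtain ⟨u, hu, hs⟩ := FiberBundle.exists_contMDiffOn_extend (k := ∞) I
    (EuclideanSpace ℝ (Fin N)) v
  obtain ⟨u', hu'u, hu'o, hpu'⟩ := mem_nhds_iff.mp hu
  obtain ⟨f, hf⟩ :=
    (SmoothBumpFunction.nhds_basis_support (I := I) (hu'o.mem_nhds hpu')).ex_mem
  have hsm := ContMDiffOn.smul_section_of_tsupport (f.contMDiff.contMDiffOn (s := u')) hu'o hf
    (hs.mono hu'u)
  refine ⟨⟨_, hsm⟩, ?_⟩
  change f p • FiberBundle.extend (EuclideanSpace ℝ (Fin N)) v p = v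
  rw [f.eq_one, one_smul, FiberBundle.extend_apply_self]

/-- A global smooth vector field with the prescribed value `v` at `p`. -/
def extendVec (p : M) (v : TangentSpace I p) : VField I M := (exists_vfield p v).choose

/-- The value `T_p(v₁, …, v_N)` at the point `p` of `T ∈ Alt^N(M)`, i.e. the value of the smooth
form that corresponds to `T`: it is `T(X₁, …, X_N)(p)` for any vector fields `X_i` such that
`X_i(p) = v_i`. -/
def valueAt (T : AltTop I M) (p : M) (v : Fin N → TangentSpace I p) : ℝ :=
  T (fun i => extendVec p (v i)) p

/-- The coordinate vector fields `∂₁, …, ∂_N` of the chart `e`, at a point `p` of its domain. -/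
def coordFrame (e : OpenPartialHomeomorph M H) (p : M) (i : Fin N) : TangentSpace I p :=
  mfderivWithin 𝓘(ℝ, EuclideanSpace ℝ (Fin N)) I (e.extend I).symm (range I) (e.extend I p)
    (EuclideanSpace.single i (1 : ℝ))

end Value

/-! ### Scalarly essentially integrable maps and maximal forms -/

section Integrable

variable {N : ℕ} {H : Type*} [TopologicalSpace H]
  (I : ModelWithCorners ℝ (EuclideanSpace ℝ (Fin N)) H)
  (M : Type*) [TopologicalSpace M] [ChartedSpace H M]
  (𝕜 : Type*) [RCLike 𝕜] (G : Type*) [AddCommGroup G] [Module 𝕜 G] [TopologicalSpace G]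

variable {M G} in
/-- `f : M → G` is scalarly essentially integrable with respect to the Lebesgue measure:
in every chart and for every continuous linear functional `ψ`, the scalar function `ψ ∘ f` read in
the chart is integrable in a neighbourhood of each point of the image of the chart. -/
def ScalarlyIntegrable (f : M → G) : Prop :=
  ∀ e ∈ IsManifold.maximalAtlas I ∞ M, ∀ ψ : StrongDual 𝕜 G,
    LocallyIntegrableOn (fun x => ψ (f ((e.extend I).symm x))) (e.extend I).target volume

variable {I M 𝕜 G}

theorem isLocallyClosed_target {M : Type*} [TopologicalSpace M] (e : OpenPartialHomeomorph M H) :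
    IsLocallyClosed (e.extend I).target := by
  rw [OpenPartialHomeomorph.extend_target]
  exact (e.open_target.preimage I.continuous_symm).isLocallyClosed.inter
    I.isClosed_range.isLocallyClosed

theorem ScalarlyIntegrable.add {f g : M → G} (hf : ScalarlyIntegrable I 𝕜 f)
    (hg : ScalarlyIntegrable I 𝕜 g) : ScalarlyIntegrable I 𝕜 (f + g) := by
  intro e he ψ
  have := (hf e he ψ).add (hg e he ψ)
  refine this.congr (Filter.Eventually.of_forall fun x => ?_)
  simp

theorem ScalarlyIntegrable.smul_continuous [Module ℝ G] [IsScalarTower ℝ 𝕜 G] {f : M → G}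
    (hf : ScalarlyIntegrable I 𝕜 f) {a : M → ℝ} (ha : Continuous a) :
    ScalarlyIntegrable I 𝕜 (fun p => a p • f p) := by
  intro e he ψ
  have hc : ContinuousOn (fun x => a ((e.extend I).symm x)) (e.extend I).target :=
    ha.comp_continuousOn (e.continuousOn_extend_symm)
  have := (hf e he ψ).continuousOn_smul (isLocallyClosed_target e) hc
  refine this.congr (Filter.Eventually.of_forall fun x => ?_)
  exact (LinearMap.map_smul_of_tower ψ.toLinearMap _ _).symm

variable (I M 𝕜 G) in
/-- The `𝒜(M)`-module `𝔏¹_c(M, G, λ)` of scalarly essentially integrable maps `M → G` with compact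
support. -/
def L1c [Module ℝ G] [IsScalarTower ℝ 𝕜 G] : Submodule (SmoothFun I M) (M → G) where
  carrier := {f | ScalarlyIntegrable I 𝕜 f ∧ HasCompactSupport f}
  zero_mem' := by
    refine ⟨fun e _ ψ => ?_, HasCompactSupport.zero⟩
    simpa using (locallyIntegrableOn_zero (s := (e.extend I).target))
  add_mem' := fun hf hg => ⟨hf.1.add hg.1, hf.2.add hg.2⟩
  smul_mem' := fun a _ hf => ⟨hf.1.smul_continuous a.contMDiff.continuous, hf.2.smul_left⟩

variable (I M 𝕜 G) in
/-- The `𝒜(M)`-module `Alt^N(M; G, λ) = 𝔏¹_c(M, G, λ) ⊗_{𝒜(M)} Alt^N(M)` of `G`-valued scalarly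
essentially integrable maximal forms on `M`. -/
abbrev MaxForm [Module ℝ G] [IsScalarTower ℝ 𝕜 G] [IsManifold I ∞ M] :=
  (L1c I M 𝕜 G) ⊗[SmoothFun I M] (AltTop I M)


end Integrable

/-! ### Operations on forms -/

section Operations

variable {N : ℕ} {H : Type*} [TopologicalSpace H]
  {I : ModelWithCorners ℝ (EuclideanSpace ℝ (Fin N)) H}
  {M : Type*} [TopologicalSpace M] [ChartedSpace H M]
  {𝕜 : Type*} [RCLike 𝕜] {G : Type*} [AddCommGroup G] [Module 𝕜 G] [TopologicalSpace G]
  [Module ℝ G] [IsScalarTower ℝ 𝕜 G]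

/-- `ψ_* : f ↦ ψ ∘ f`, for a continuous linear functional `ψ` on `G`. -/
def pushFun (ψ : StrongDual 𝕜 G) : L1c I M 𝕜 G →ₗ[SmoothFun I M] L1c I M 𝕜 𝕜 where
  toFun f := ⟨fun p => ψ (f.1 p),
    fun e he χ => f.2.1 e he (χ.comp ψ), f.2.2.comp_left (map_zero ψ)⟩
  map_add' f g := by ext p; exact map_add ψ _ _
  map_smul' a f := by ext p; exact LinearMap.map_smul_of_tower ψ.toLinearMap (a p) (f.1 p)

/-- Composition of a `𝕜`-valued integrable map with a real linear functional of `𝕜`, to be applied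
to the real and the imaginary part. -/
def partFun (L : StrongDual ℝ 𝕜) : L1c I M 𝕜 𝕜 →ₗ[SmoothFun I M] L1c I M ℝ ℝ where
  toFun f := ⟨fun p => L (f.1 p),
    fun e he χ => (χ.comp L).locallyIntegrableOn_comp
      (f.2.1 e he (ContinuousLinearMap.id 𝕜 𝕜)), f.2.2.comp_left (map_zero L)⟩
  map_add' f g := by ext p; exact map_add L _ _
  map_smul' a f := by ext p; exact map_smul L (a p) (f.1 p)

/-- Multiplication of an integrable map by a compactly supported continuous real function. -/
def mulFun (g : C_c(M, ℝ)) : L1c I M 𝕜 G →ₗ[SmoothFun I M] L1c I M 𝕜 G where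
  toFun f := ⟨fun p => g p • f.1 p, f.2.1.smul_continuous g.continuous, f.2.2.smul_left⟩
  map_add' f g := by ext p; exact smul_add _ _ _
  map_smul' a f := by ext p; exact smul_comm (g p) (a p) (f.1 p)

variable [IsManifold I ∞ M]

/-- The pushforward `ψ_× = ψ_* ⊗ Id` of forms. -/
def pushForm (ψ : StrongDual 𝕜 G) : MaxForm I M 𝕜 G →ₗ[SmoothFun I M] MaxForm I M 𝕜 𝕜 :=
  TensorProduct.map (pushFun ψ) LinearMap.id

/-- The real part of a `𝕜`-valued form. -/
def reForm : MaxForm I M 𝕜 𝕜 →ₗ[SmoothFun I M] MaxForm I M ℝ ℝ :=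
  TensorProduct.map (partFun RCLike.reCLM) LinearMap.id

/-- The imaginary part of a `𝕜`-valued form (which is zero if `𝕜 = ℝ`). -/
def imForm : MaxForm I M 𝕜 𝕜 →ₗ[SmoothFun I M] MaxForm I M ℝ ℝ :=
  TensorProduct.map (partFun RCLike.imCLM) LinearMap.id

/-- The product `g · η` of a compactly supported continuous function and a form:
`g · (f ⊗ T) = (g f) ⊗ T`. -/
def mulForm (g : C_c(M, ℝ)) : MaxForm I M 𝕜 G →ₗ[SmoothFun I M] MaxForm I M 𝕜 G :=
  TensorProduct.map (mulFun g) LinearMap.id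

variable [T2Space M]

/-- The values of a form on a field `V` of `N`-tuples of tangent vectors:
`f ⊗ T` is sent to `p ↦ T_p(V₁(p), …, V_N(p)) f(p)`. -/
def evalForm (V : ∀ p : M, Fin N → TangentSpace I p) :
    MaxForm I M 𝕜 G →ₗ[SmoothFun I M] (M → G) :=
  TensorProduct.lift (LinearMap.mk₂ (SmoothFun I M)
    (fun (f : L1c I M 𝕜 G) (T : AltTop I M) (p : M) => valueAt T p (V p) • f.1 p)
    (fun f g T => by funext p; exact smul_add _ _ _)
    (fun a f T => by funext p; exact smul_comm _ (a p) (f.1 p))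
    (fun f S T => by funext p; exact add_smul _ _ _)
    (fun a f T => by funext p; exact mul_smul (a p) _ (f.1 p)))

/-- The support of a form: the closure of the set of points at which its value is not zero. -/
def formSupport (θ : MaxForm I M 𝕜 G) : Set M :=
  closure {p | ∃ V : ∀ q : M, Fin N → TangentSpace I q, evalForm V θ p ≠ 0}

theorem isCompact_formSupport (θ : MaxForm I M 𝕜 G) : IsCompact (formSupport θ) := by
  suffices h : ∃ K : Set M, IsCompact K ∧ ∀ p ∉ K,
      ∀ V : ∀ q : M, Fin N → TangentSpace I q, evalForm V θ p = 0 by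
    obtain ⟨K, hK, h0⟩ := h
    refine hK.of_isClosed_subset isClosed_closure (closure_minimal ?_ hK.isClosed)
    rintro p ⟨V, hV⟩
    by_contra hp
    exact hV (h0 p hp V)
  induction θ using TensorProduct.induction_on with
  | zero => exact ⟨∅, isCompact_empty, fun p _ V => by rw [map_zero]; rfl⟩
  | tmul f T =>
    refine ⟨tsupport f.1, f.2.2, fun p hp V => ?_⟩
    change valueAt T p (V p) • f.1 p = 0
    rw [image_eq_zero_of_notMem_tsupport hp, smul_zero]
  | add x y hx hy =>
    obtain ⟨K, hK, hx⟩ := hx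
    obtain ⟨L, hL, hy⟩ := hy
    refine ⟨K ∪ L, hK.union hL, fun p hp V => ?_⟩
    rw [map_add, Pi.add_apply, hx p (fun h => hp (Or.inl h)), hy p (fun h => hp (Or.inr h)),
      add_zero]

end Operations

/-! ### Orientations and the integral -/

section Integral

variable {N : ℕ} {H : Type*} [TopologicalSpace H]
  (I : ModelWithCorners ℝ (EuclideanSpace ℝ (Fin N)) H)
  (M : Type*) [TopologicalSpace M] [ChartedSpace H M] [IsManifold I ∞ M] [T2Space M]

variable {I M} in
/-- On the domain of the chart `e`, the orientation of each tangent space given by `o` is that of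
the coordinate basis. -/
def IsPositiveChart (o : ∀ p : M, Orientation ℝ (TangentSpace I p) (Fin N))
    (e : OpenPartialHomeomorph M H) : Prop :=
  ∀ p ∈ e.source, ∃ b : Module.Basis (Fin N) ℝ (TangentSpace I p),
    (∀ i, b i = coordFrame e p i) ∧ b.orientation = o p

variable {I M} in
/-- On the domain of the chart `e`, the orientation of each tangent space given by `o` is opposite
to that of the coordinate basis. -/
def IsNegativeChart (o : ∀ p : M, Orientation ℝ (TangentSpace I p) (Fin N))
    (e : OpenPartialHomeomorph M H) : Prop :=
  ∀ p ∈ e.source, ∃ b : Module.Basis (Fin N) ℝ (TangentSpace I p),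
    (∀ i, b i = coordFrame e p i) ∧ b.orientation = -o p

/-- An orientation of the manifold `M`: an orientation of every tangent space, which depends
continuously on the point, i.e. `M` is covered by charts that are positively or negatively
oriented. -/
structure ManifoldOrientation where
  /-- the orientation of the tangent space at a point -/
  orient : ∀ p : M, Orientation ℝ (TangentSpace I p) (Fin N)
  exists_chart : ∀ p : M, ∃ e ∈ IsManifold.maximalAtlas I ∞ M, p ∈ e.source ∧
    (IsPositiveChart orient e ∨ IsNegativeChart orient e)

variable {I M}

/-- A finite family of oriented charts covering the set `S`, with a smooth partition of unity
subordinate to the covering of `M` by the domains of these charts and the complement of `S`. -/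
structure OrientedCover (o : ManifoldOrientation I M) (S : Set M) where
  /-- the number of charts -/
  n : ℕ
  /-- the charts -/
  chart : Fin n → OpenPartialHomeomorph M H
  chart_mem : ∀ a, chart a ∈ IsManifold.maximalAtlas I ∞ M
  oriented : ∀ a, IsPositiveChart o.orient (chart a) ∨ IsNegativeChart o.orient (chart a)
  cover : S ⊆ ⋃ a, (chart a).source
  /-- the partition of unity, where `none` is the index of the complement of `S` -/
  pou : SmoothPartitionOfUnity (Option (Fin n)) I M univ
  subordinate : pou.IsSubordinate (fun j => j.elim Sᶜ (fun a => (chart a).source))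

theorem nonempty_orientedCover [SigmaCompactSpace M] (o : ManifoldOrientation I M) {S : Set M}
    (hS : IsCompact S) : Nonempty (OrientedCover o S) := by
  choose e he hpe ho using o.exists_chart
  obtain ⟨t, ht⟩ := hS.elim_finite_subcover (fun p => (e p).source) (fun p => (e p).open_source)
    (fun p _ => mem_iUnion.mpr ⟨p, hpe p⟩)
  have hcov : S ⊆ ⋃ a : Fin t.card, (e (t.equivFin.symm a)).source := by
    intro p hp
    obtain ⟨q, hq, hpq⟩ := mem_iUnion₂.mp (ht hp)
    exact mem_iUnion.mpr ⟨t.equivFin ⟨q, hq⟩, by simpa using hpq⟩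
  obtain ⟨f, hf⟩ := SmoothPartitionOfUnity.exists_isSubordinate I (isClosed_univ (X := M))
    (fun j : Option (Fin t.card) => j.elim Sᶜ (fun a => (e (t.equivFin.symm a)).source))
    (by rintro (_ | a)
        · exact hS.isClosed.isOpen_compl
        · exact (e _).open_source)
    (by intro p _
        by_cases hp : p ∈ S
        · obtain ⟨a, ha⟩ := mem_iUnion.mp (hcov hp)
          exact mem_iUnion.mpr ⟨some a, ha⟩
        · exact mem_iUnion.mpr ⟨none, hp⟩)
  exact ⟨⟨t.card, fun a => e (t.equivFin.symm a), fun a => he _, fun a => ho _, hcov, f, hf⟩⟩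

/-- The integral over `e(U) ⊆ ℝ^N` of the coefficient `f` of the pullback
`(e⁻¹)^× θ = f dx₁ ∧ … ∧ dx_N` of the form `θ` by the inverse of the chart `e : U → ℝ^N`;
this coefficient is the value of `θ` on the coordinate vector fields. -/
def chartIntegral (e : OpenPartialHomeomorph M H) (θ : MaxForm I M ℝ ℝ) : ℝ :=
  ∫ x in (e.extend I).target, evalForm (coordFrame e) θ ((e.extend I).symm x)

open Classical in
/-- The sign of an oriented chart. -/
def chartSign (o : ManifoldOrientation I M) (e : OpenPartialHomeomorph M H) : ℝ :=
  if IsPositiveChart o.orient e then 1 else -1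

/-- The sum `∑_α γ_α ∫ (φ_α⁻¹)^×(ψ_α θ)` over the charts `φ_α` of an oriented cover. -/
def OrientedCover.sum {o : ManifoldOrientation I M} {S : Set M} (D : OrientedCover o S)
    (θ : MaxForm I M ℝ ℝ) : ℝ :=
  ∑ a, chartSign o (D.chart a) * chartIntegral (D.chart a) (D.pou (some a) • θ)

variable [SigmaCompactSpace M]

/-- The integral of a real valued maximal form, computed by any finite family of oriented charts
covering its support and any subordinate partition of unity (one such choice is made here). -/
def realIntegral (o : ManifoldOrientation I M) (θ : MaxForm I M ℝ ℝ) : ℝ :=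
  (Classical.choice (nonempty_orientedCover o (isCompact_formSupport θ))).sum θ

/-- The integral of a `𝕜`-valued maximal form, `∫ θ = ∫ Re θ + i ∫ Im θ`. -/
def scalarIntegral {𝕜 : Type*} [RCLike 𝕜] (o : ManifoldOrientation I M)
    (θ : MaxForm I M 𝕜 𝕜) : 𝕜 :=
  (realIntegral o (reForm θ) : 𝕜) + RCLike.I * (realIntegral o (imForm θ) : 𝕜)

/-- The weak integral of a `G`-valued maximal form `η`: the map `ψ ↦ ∫ ψ_×(η)` on `G'`. -/
def weakIntegral {𝕜 : Type*} [RCLike 𝕜] {G : Type*} [AddCommGroup G] [Module 𝕜 G]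
    [TopologicalSpace G] [Module ℝ G] [IsScalarTower ℝ 𝕜 G]
    (o : ManifoldOrientation I M) (η : MaxForm I M 𝕜 G) (ψ : StrongDual 𝕜 G) : 𝕜 :=
  scalarIntegral o (pushForm ψ η)

end Integral

/-! ### Vector measures -/

section Measures

variable (X : Type*) [TopologicalSpace X]

/-- The topology of uniform convergence on the space `ℋ(X, K)` of the continuous functions with
support in `K`. -/
abbrev supportedTopology (K : TopologicalSpace.Compacts X) :
    TopologicalSpace {f : C_c(X, ℝ) // tsupport f ⊆ K} :=
  TopologicalSpace.induced (fun f => UniformFun.ofFun (f.1 : X → ℝ)) inferInstance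

/-- The usual topology of the space `ℋ(X) = C_c(X, ℝ)`: the inductive limit, in the category of
locally convex spaces, of the spaces `ℋ(X, K)` for `K ⊆ X` compact, i.e. the finest locally convex
topology for which the inclusions `ℋ(X, K) → ℋ(X)` are continuous. -/
instance instTopologicalSpaceCc : TopologicalSpace C_c(X, ℝ) :=
  sInf {t : TopologicalSpace C_c(X, ℝ) |
    (∀ K : TopologicalSpace.Compacts X,
      @Continuous _ _ (supportedTopology X K) t Subtype.val) ∧
    @IsTopologicalAddGroup C_c(X, ℝ) t _ ∧
    @ContinuousSMul ℝ C_c(X, ℝ) _ _ t ∧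
    @LocallyConvexSpace ℝ C_c(X, ℝ) _ _ _ _ t}

/-- The space of vector measures on `X` with values in `E`: the continuous linear maps
`ℋ(X) → E`. -/
abbrev Meas (E : Type*) [AddCommGroup E] [Module ℝ E] [TopologicalSpace E] :=
  C_c(X, ℝ) →L[ℝ] E

variable (𝕜 : Type*) [RCLike 𝕜] (G : Type*) [AddCommGroup G] [Module 𝕜 G] [TopologicalSpace G]

/-- `G^⋆`: the algebraic dual `(G')^*` of the topological dual `G'` of `G`, with the weak topology
`σ((G')^*, G')`. -/
abbrev GStar :=
  WeakBilin (LinearMap.id : Module.Dual 𝕜 (StrongDual 𝕜 G) →ₗ[𝕜] Module.Dual 𝕜 (StrongDual 𝕜 G))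

instance instContinuousSMulGStar : ContinuousSMul ℝ (GStar 𝕜 G) where
  continuous_smul := by
    have h : Continuous fun p : ℝ × GStar 𝕜 G => ((p.1 : 𝕜), p.2) := by fun_prop
    refine (continuous_smul.comp h).congr fun p => ?_
    exact RCLike.real_smul_eq_coe_smul (K := 𝕜) p.1 p.2 |>.symm

variable {𝕜 G} in
/-- The value `z(ψ)` of `z ∈ (G')^*` at `ψ ∈ G'`. -/
def GStar.eval (z : GStar 𝕜 G) (ψ : StrongDual 𝕜 G) : 𝕜 :=
  (LinearMap.id : Module.Dual 𝕜 (StrongDual 𝕜 G) →ₗ[𝕜] Module.Dual 𝕜 (StrongDual 𝕜 G)) z ψ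

end Measures

end IntegrableForm

end

/-! Uniqueness is immediate, since the formula prescribes every value `m η g ψ`. For existence, the
integral, defined through one arbitrary choice of charts and partition of unity, must be linear in
the form, the weak integral `𝕜`-linear in `ψ`, and `g ↦ ∫ g · η` continuous.

Linearity follows from independence of the choice (`OrientedCover.sum_eq_sum`): forms can then be
integrated with one cover of the union of their supports. Independence is the change of variables
formula: values on coordinate frames transform by the Jacobian determinant
(`evalForm_coordFrame_eq_det_mul`), and the signs of the charts turn it into its absolute value
(`chartSign_mul_det`). This presupposes that an element of `AltTop`, which only acts on global
vector fields, has pointwise values (`altTop_apply_congr`).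

For continuity, the weak topology tests one `ψ` at a time, and then `|∫ g · θ| ≤ C sup |g|`, where
`C` is built from `L¹` norms of local coefficients (`exists_abs_realIntegral_mulForm_le`). The
inductive limit topology makes such a bound sufficient (`continuous_of_norm_le`). -/

noncomputable section

namespace IntegrableForm

/-! ### Pointwise values of elements of `AltTop`. -/

section Tensoriality

variable {N : ℕ} {H : Type*} [TopologicalSpace H]
  {I : ModelWithCorners ℝ (EuclideanSpace ℝ (Fin N)) H}
  {M : Type*} [TopologicalSpace M] [ChartedSpace H M] [IsManifold I ∞ M] [T2Space M]

theorem extendVec_apply (p : M) (v : TangentSpace I p) : extendVec (I := I) p v p = v :=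
  (exists_vfield p v).choose_spec

variable (I) in
/-- A smooth function which is `1` near `p` and has its support in a given neighbourhood of `p`. -/
theorem exists_smooth_cutoff {p : M} {s : Set M} (hs : s ∈ nhds p) :
    ∃ χ : SmoothFun I M, (∀ᶠ q in nhds p, χ q = 1) ∧ tsupport χ ⊆ s := by
  obtain ⟨f, -, hf⟩ := (SmoothBumpFunction.nhds_basis_tsupport (I := I) p).mem_iff.mp hs
  exact ⟨⟨f, f.contMDiff⟩, f.eventuallyEq_one, hf⟩

/-- The product of a smooth function and a vector field that is smooth near its support. -/
def cutoffField (χ : SmoothFun I M) {u : Set M} (hu : IsOpen u) (hχ : tsupport χ ⊆ u)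
    (σ : ∀ p : M, TangentSpace I p)
    (hσ : ContMDiffOn I (I.prod 𝓘(ℝ, EuclideanSpace ℝ (Fin N))) ∞
      (fun p => (⟨p, σ p⟩ : TangentBundle I M)) u) : VField I M :=
  ⟨fun p => χ p • σ p, ContMDiffOn.smul_section_of_tsupport χ.contMDiff.contMDiffOn hu hχ hσ⟩

/-- A vector field that vanishes at `p` is, near `p`, a combination of vector fields with
coefficients that vanish at `p`. -/
theorem exists_smul_eq_sum_of_apply_eq_zero (X : VField I M) (p : M) (hX : X p = 0) :
    ∃ (χ : SmoothFun I M) (a : Fin N → SmoothFun I M) (Y : Fin N → VField I M),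
      χ p = 1 ∧ (∀ j, a j p = 0) ∧ χ • X = ∑ j, a j • Y j := by
  let t := trivializationAt (EuclideanSpace ℝ (Fin N)) (TangentSpace I : M → Type _) p
  have hp : p ∈ t.baseSet := FiberBundle.mem_baseSet_trivializationAt _ _ p
  let b := (EuclideanSpace.basisFun (Fin N) ℝ).toBasis
  obtain ⟨χ, h1, hs⟩ := exists_smooth_cutoff I (t.open_baseSet.mem_nhds hp)
  have hc (j : Fin N) : ContMDiff I 𝓘(ℝ, ℝ) ∞
      (fun q => χ q * t.localFrameCoeff I b j q (X q)) := by
    refine contMDiff_of_tsupport fun q hq => ?_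
    have hq' : q ∈ t.baseSet := hs (tsupport_mul_subset_left hq)
    exact (χ.contMDiff q).mul (contMDiffAt_localFrameCoeff b hq' (X.contMDiff q) j)
  let a : Fin N → SmoothFun I M := fun j => ⟨_, hc j⟩
  -- Two cutoffs are spent: one makes the frame coefficients of `X` globally smooth, the other makes
  -- the local frame fields global. Hence the square.
  refine ⟨χ * χ, a, fun j => cutoffField χ t.open_baseSet hs
    (t.localFrame b j) (t.contMDiffOn_localFrame_baseSet ∞ b j), ?_, fun j => ?_, ?_⟩
  · simp [h1.self_of_nhds]
  · change χ p * t.localFrameCoeff I b j p (X p) = 0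
    rw [hX, map_zero, mul_zero]
  · ext1 q
    have hsum : (∑ j, a j • cutoffField χ t.open_baseSet hs
        (t.localFrame b j) (t.contMDiffOn_localFrame_baseSet ∞ b j)) q =
        ∑ j, (χ q * t.localFrameCoeff I b j q (X q)) • χ q • t.localFrame b j q := by
      rw [← ContMDiffSection.coeAddHom_apply, map_sum, Finset.sum_apply]
      rfl
    rw [hsum]
    change (χ q * χ q) • X q = _
    by_cases hq : q ∈ t.baseSet
    · conv_lhs => rw [t.eq_sum_localFrameCoeff_smul (I := I) (b := b) (s := X) hq]
      rw [Finset.smul_sum]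
      refine Finset.sum_congr rfl fun j _ => ?_
      simp only [smul_smul]
      congr 1
      ring
    · have : χ q = 0 := image_eq_zero_of_notMem_tsupport fun h => hq (hs h)
      simp [this]

/-- Multilinearity over the smooth functions moves the cutoff and the coefficients out of `T`; at
`p` the cutoff is `1` and the coefficients vanish. -/
theorem altTop_apply_eq_zero (T : AltTop I M) (X : Fin N → VField I M) (i : Fin N) (p : M)
    (h : X i p = 0) : T X p = 0 := by
  obtain ⟨χ, a, Y, h1, ha, hsum⟩ := exists_smul_eq_sum_of_apply_eq_zero (X i) p h
  have : χ * T X = ∑ j, a j * T (update X i (Y j)) := by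
    calc χ * T X = T (update X i (χ • X i)) := by
          rw [AlternatingMap.map_update_smul, update_eq_self, smul_eq_mul]
      _ = _ := by
          rw [hsum, AlternatingMap.map_update_sum]
          simp only [AlternatingMap.map_update_smul, smul_eq_mul]
  have h2 := congrArg (fun f : SmoothFun I M => f p) this
  simp only [ContMDiffMap.coe_mul, Pi.mul_apply, h1, one_mul] at h2
  rw [h2, ← ContMDiffMap.coeFnAddMonoidHom_apply, map_sum, Finset.sum_apply]
  refine Finset.sum_eq_zero fun j _ => ?_
  change a j p * _ = 0
  rw [ha, zero_mul]

theorem altTop_apply_congr (T : AltTop I M) {X Y : Fin N → VField I M} {p : M}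
    (h : ∀ i, X i p = Y i p) : T X p = T Y p := by
  classical
  -- The arguments are exchanged one at a time; each exchange changes `T` by a term with an argument
  -- that vanishes at `p`.
  have key : ∀ s : Finset (Fin N), T (s.piecewise X Y) p = T Y p := by
    intro s
    induction s using Finset.induction_on with
    | empty => simp
    | insert i s hi ih =>
      rw [← ih, Finset.piecewise_insert, ← sub_eq_zero]
      have h3 : s.piecewise X Y = update (s.piecewise X Y) i (Y i) := by
        rw [eq_comm, update_eq_self_iff, Finset.piecewise_eq_of_notMem _ _ _ hi]
      conv_lhs => enter [2]; rw [h3]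
      have h4 := AlternatingMap.map_update_sub T (s.piecewise X Y) i (X i) (Y i)
      have h5 := congrArg (fun f : SmoothFun I M => f p) h4
      simp only [ContMDiffMap.coe_sub, Pi.sub_apply] at h5
      rw [← h5]
      refine altTop_apply_eq_zero T _ i p ?_
      rw [update_self, ContMDiffSection.coe_sub, Pi.sub_apply, h i, sub_self]
  simpa using key Finset.univ

/-- This removes the arbitrary extensions chosen in `extendVec`: any convenient fields may be used
to compute a value. -/
theorem valueAt_eq (T : AltTop I M) (X : Fin N → VField I M) (p : M)
    {v : Fin N → TangentSpace I p} (h : ∀ i, X i p = v i) : valueAt T p v = T X p :=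
  altTop_apply_congr T fun i => (extendVec_apply _ _).trans (h i).symm

/-- The value of `T ∈ Alt^N(M)` at `p`, as an alternating form on the tangent space. -/
def valueAlt (T : AltTop I M) (p : M) : TangentSpace I p [⋀^Fin N]→ₗ[ℝ] ℝ where
  toFun := valueAt T p
  map_update_add' := by
    intro dec v i x y
    obtain rfl : dec = instDecidableEqFin N := Subsingleton.elim _ _
    have h1 := valueAt_eq T (update (fun j => extendVec p (v j)) i
      (extendVec p x + extendVec p y)) p (v := update v i (x + y)) fun j => by
        rcases eq_or_ne j i with rfl | hj
        · simp [extendVec_apply]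
        · simp [hj, extendVec_apply]
    have h2 : ∀ z, valueAt T p (update v i z) = T (update (fun j => extendVec p (v j)) i
        (extendVec p z)) p := fun z => valueAt_eq T _ p fun j => by
        rcases eq_or_ne j i with rfl | hj
        · simp [extendVec_apply]
        · simp [hj, extendVec_apply]
    refine h1.trans ?_
    rw [h2, h2, AlternatingMap.map_update_add]
    rfl
  map_update_smul' := by
    intro dec v i c x
    obtain rfl : dec = instDecidableEqFin N := Subsingleton.elim _ _
    -- The real scalar enters as a constant function, because `T` is linear over the smooth
    -- functions.
    have h1 := valueAt_eq T (update (fun j => extendVec p (v j)) i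
      (algebraMap ℝ (SmoothFun I M) c • extendVec p x)) p (v := update v i (c • x)) fun j => by
        rcases eq_or_ne j i with rfl | hj
        · rw [update_self, update_self, vfield_smul_apply, extendVec_apply]
          rfl
        · simp [hj, extendVec_apply]
    have h2 : valueAt T p (update v i x) = T (update (fun j => extendVec p (v j)) i
        (extendVec p x)) p := valueAt_eq T _ p fun j => by
        rcases eq_or_ne j i with rfl | hj
        · simp [extendVec_apply]
        · simp [hj, extendVec_apply]
    refine h1.trans ?_
    rw [h2, AlternatingMap.map_update_smul]
    rfl
  map_eq_zero_of_eq' := by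
    intro v i j hij hne
    change T _ p = 0
    rw [AlternatingMap.map_eq_zero_of_eq T _ (by simp only [hij]) hne]
    rfl

/-- The pullback of `f` by `D` is a top degree form on `ℝ^N`, hence a multiple of the determinant in
the standard basis. -/
theorem alternatingMap_comp_eq_det_mul {V : Type*} [AddCommGroup V] [Module ℝ V]
    (f : V [⋀^Fin N]→ₗ[ℝ] ℝ) (D : EuclideanSpace ℝ (Fin N) →ₗ[ℝ] V)
    (A : EuclideanSpace ℝ (Fin N) →ₗ[ℝ] EuclideanSpace ℝ (Fin N)) :
    f (fun i => D (A (EuclideanSpace.single i 1))) =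
      LinearMap.det A * f (fun i => D (EuclideanSpace.single i 1)) := by
  let b := (EuclideanSpace.basisFun (Fin N) ℝ).toBasis
  have hb : ∀ i, b i = EuclideanSpace.single i 1 := fun i => by simp [b]
  have h := congrArg (fun f => f (A ∘ b))
    (AlternatingMap.eq_smul_basis_det b (f.compLinearMap D))
  simp only [AlternatingMap.smul_apply, Module.Basis.det_comp, Module.Basis.det_self, mul_one,
    AlternatingMap.compLinearMap_apply, smul_eq_mul, comp_apply, hb] at h
  rw [mul_comm]
  exact h

end Tensoriality

/-! ### Coordinate frames and their transformation under a change of charts. -/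

section Frame

variable {N : ℕ} {H : Type*} [TopologicalSpace H]
  {I : ModelWithCorners ℝ (EuclideanSpace ℝ (Fin N)) H}
  {M : Type*} [TopologicalSpace M] [ChartedSpace H M] [IsManifold I ∞ M]
  {e : OpenPartialHomeomorph M H}

theorem uniqueDiffOn_extend_target {M : Type*} [TopologicalSpace M]
    (e : OpenPartialHomeomorph M H) : UniqueDiffOn ℝ (e.extend I).target := by
  rw [OpenPartialHomeomorph.extend_target]
  exact I.uniqueDiffOn_preimage e.open_target

/-- The coordinate field is the constant field transported by the tangent map of the inverse chart.
-/
theorem contMDiffOn_coordFrame (he : e ∈ IsManifold.maximalAtlas I ∞ M) [T2Space M] (i : Fin N) :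
    ContMDiffOn I (I.prod 𝓘(ℝ, EuclideanSpace ℝ (Fin N))) ∞
      (fun p => (⟨p, coordFrame e p i⟩ : TangentBundle I M)) e.source := by
  have h1 := (contMDiffOn_extend_symm he).contMDiffOn_tangentMapWithin (m := ∞) (by simp)
    (by rw [← OpenPartialHomeomorph.extend_target']
        exact (uniqueDiffOn_extend_target e).uniqueMDiffOn)
  rw [← OpenPartialHomeomorph.extend_target'] at h1
  have h2 : ContMDiff 𝓘(ℝ, EuclideanSpace ℝ (Fin N)) (𝓘(ℝ, EuclideanSpace ℝ (Fin N)).tangent) ∞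
      (fun x => (⟨x, EuclideanSpace.single i (1 : ℝ)⟩ :
        TangentBundle 𝓘(ℝ, EuclideanSpace ℝ (Fin N)) (EuclideanSpace ℝ (Fin N)))) :=
    contMDiff_vectorSpace_iff_contDiff.mpr contDiff_const
  have h3 := h1.comp (h2.comp_contMDiffOn (OpenPartialHomeomorph.contMDiffOn_extend he))
    (fun p hp => by
      change e.extend I p ∈ (e.extend I).target
      exact (e.extend I).map_source (by rwa [e.extend_source]))
  refine h3.congr fun p hp => ?_
  have hp' : p ∈ (e.extend I).source := by rwa [e.extend_source]
  have h4 : (e.extend I).symm (e.extend I p) = p := (e.extend I).left_inv hp'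
  -- `coordFrame` differentiates within `range I`, the tangent map within the chart target; near the
  -- point both sets agree, also at the boundary.
  have h5 := mfderivWithin_congr_set (I := 𝓘(ℝ, EuclideanSpace ℝ (Fin N))) (I' := I)
    (f := (e.extend I).symm) (e.extend_target_eventuallyEq (I := I) hp)
  refine Bundle.TotalSpace.ext h4.symm (heq_of_eq ?_)
  exact congrArg (fun L => L (EuclideanSpace.single i (1 : ℝ))) h5.symm

/-- Near `p` the coefficient coincides with the smooth function obtained by applying `T` to cut off
coordinate fields. -/
theorem continuousOn_valueAt_coordFrame [T2Space M] (he : e ∈ IsManifold.maximalAtlas I ∞ M)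
    (T : AltTop I M) : ContinuousOn (fun p => valueAt T p (coordFrame e p)) e.source := by
  intro p hp
  obtain ⟨χ, h1, hs⟩ := exists_smooth_cutoff I (e.open_source.mem_nhds hp)
  let X : Fin N → VField I M := fun i => cutoffField χ e.open_source hs
    (fun p => coordFrame e p i) (contMDiffOn_coordFrame he i)
  have hX : ContinuousAt (T X) p := (T X).contMDiff.continuous.continuousAt
  refine (hX.congr ?_).continuousWithinAt
  filter_upwards [h1] with q hq
  refine (valueAt_eq T X q fun i => ?_).symm
  change χ q • coordFrame e q i = _
  rw [hq, one_smul]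

/-- The differential of the inverse of the chart `e`, at the point `p` of its domain. -/
def frameMap (I : ModelWithCorners ℝ (EuclideanSpace ℝ (Fin N)) H)
    (e : OpenPartialHomeomorph M H) (p : M) : EuclideanSpace ℝ (Fin N) →ₗ[ℝ] TangentSpace I p :=
  (mfderivWithin 𝓘(ℝ, EuclideanSpace ℝ (Fin N)) I (e.extend I).symm (range I)
    (e.extend I p)).toLinearMap

omit [IsManifold I ∞ M] in
theorem frameMap_single (p : M) (i : Fin N) :
    frameMap I e p (EuclideanSpace.single i 1) = coordFrame e p i := rfl

/-- The differential of the change of charts from `e` to `e'`. -/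
def coordChangeDeriv (I : ModelWithCorners ℝ (EuclideanSpace ℝ (Fin N)) H)
    (e e' : OpenPartialHomeomorph M H) (x : EuclideanSpace ℝ (Fin N)) :
    EuclideanSpace ℝ (Fin N) →L[ℝ] EuclideanSpace ℝ (Fin N) :=
  fderivWithin ℝ (I.extendCoordChange e e') (I.extendCoordChange e e').source x

omit [IsManifold I ∞ M] in
theorem hasFDerivWithinAt_extendCoordChange {e' : OpenPartialHomeomorph M H}
    (he : e ∈ IsManifold.maximalAtlas I ∞ M) (he' : e' ∈ IsManifold.maximalAtlas I ∞ M)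
    {x : EuclideanSpace ℝ (Fin N)} (hx : x ∈ (I.extendCoordChange e e').source) :
    HasFDerivWithinAt (I.extendCoordChange e e') (coordChangeDeriv I e e' x)
      (I.extendCoordChange e e').source x :=
  ((I.contDiffOn_extendCoordChange he he' x hx).differentiableWithinAt
    (by simp)).hasFDerivWithinAt

omit [IsManifold I ∞ M] in
-- This is the chain rule for the inverse of `e`, written as the inverse of `e'` after the change of
-- charts. At boundary points all derivatives are taken within sets with unique derivatives.
theorem frameMap_eq_comp {e' : OpenPartialHomeomorph M H}
    (he : e ∈ IsManifold.maximalAtlas I ∞ M) (he' : e' ∈ IsManifold.maximalAtlas I ∞ M)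
    {p : M} (hp : p ∈ e.source) (hp' : p ∈ e'.source) (v : EuclideanSpace ℝ (Fin N)) :
    frameMap I e p v = frameMap I e' p (coordChangeDeriv I e e' (e.extend I p) v) := by
  set s := (I.extendCoordChange e e').source with hs
  set x := e.extend I p with hx
  have hq : (e.extend I).symm x = p := (e.extend I).left_inv (by rwa [e.extend_source])
  have hq' : (e'.extend I).symm (e'.extend I p) = p :=
    (e'.extend I).left_inv (by rwa [e'.extend_source])
  have hxs : x ∈ s := by
    rw [hs, ← OpenPartialHomeomorph.extend_image_source_inter]
    exact mem_image_of_mem _ ⟨hp, hp'⟩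
  have hcx : I.extendCoordChange e e' x = e'.extend I p := by
    change e'.extend I ((e.extend I).symm x) = _
    rw [hq]
  have hst : s ⊆ (e.extend I).target := fun y hy => hy.1
  have hset : s =ᶠ[nhds x] range I :=
    nhdsWithin_eq_iff_eventuallyEq.1 (le_antisymm
      (nhdsWithin_mono x (hst.trans e.extend_target_subset_range))
      (nhdsWithin_le_of_mem (I.extendCoordChange_source_mem_nhdsWithin hxs)))
  have hu : UniqueMDiffWithinAt 𝓘(ℝ, EuclideanSpace ℝ (Fin N)) s x :=
    (I.uniqueDiffOn_extendCoordChange_source x hxs).uniqueMDiffWithinAt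
  have hd : MDifferentiableWithinAt 𝓘(ℝ, EuclideanSpace ℝ (Fin N))
      𝓘(ℝ, EuclideanSpace ℝ (Fin N)) (I.extendCoordChange e e') s x :=
    (hasFDerivWithinAt_extendCoordChange he he' hxs).differentiableWithinAt.mdifferentiableWithinAt
  have hmem' : e'.extend I p ∈ (e'.extend I).target :=
    (e'.extend I).map_source (by rwa [e'.extend_source])
  have hd' : MDifferentiableWithinAt 𝓘(ℝ, EuclideanSpace ℝ (Fin N)) I (e'.extend I).symm
      (e'.extend I).target (e'.extend I p) := by
    refine (contMDiffOn_extend_symm he').mdifferentiableOn (by simp) _ ?_ |>.mono ?_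
    all_goals rw [← OpenPartialHomeomorph.extend_target']
    exact hmem'
  have hmaps : s ⊆ I.extendCoordChange e e' ⁻¹' (e'.extend I).target := fun y hy =>
    (I.extendCoordChange e e').map_source hy |>.1
  have h1 := mfderivWithin_congr_set (I := 𝓘(ℝ, EuclideanSpace ℝ (Fin N))) (I' := I)
    (f := (e.extend I).symm) hset
  have h2 : mfderivWithin 𝓘(ℝ, EuclideanSpace ℝ (Fin N)) I (e.extend I).symm s x =
      mfderivWithin 𝓘(ℝ, EuclideanSpace ℝ (Fin N)) I
        ((e'.extend I).symm ∘ I.extendCoordChange e e') s x := by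
    refine mfderivWithin_congr_of_mem (fun y hy => ?_) hxs
    exact ((e'.extend I).left_inv hy.2).symm
  have h3 := mfderivWithin_comp_of_eq hd' hd hmaps hu hcx
  have h4 := mfderivWithin_congr_set (I := 𝓘(ℝ, EuclideanSpace ℝ (Fin N))) (I' := I)
    (f := (e'.extend I).symm) (e'.extend_target_eventuallyEq (I := I) hp')
  have h5 : mfderivWithin 𝓘(ℝ, EuclideanSpace ℝ (Fin N)) 𝓘(ℝ, EuclideanSpace ℝ (Fin N))
      (I.extendCoordChange e e') s x = coordChangeDeriv I e e' x := mfderivWithin_eq_fderivWithin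
  rw [h4, h5] at h3
  -- The equalities concern tangent spaces at points that are only propositionally equal; reading
  -- everything in the model space lets them be chained.
  exact (congrArg (fun L : EuclideanSpace ℝ (Fin N) →L[ℝ] EuclideanSpace ℝ (Fin N) => L v)
    h1.symm).trans ((congrArg (fun L : EuclideanSpace ℝ (Fin N) →L[ℝ] EuclideanSpace ℝ (Fin N) =>
      L v) h2).trans (congrArg (fun L : EuclideanSpace ℝ (Fin N) →L[ℝ] EuclideanSpace ℝ (Fin N) =>
      L v) h3))

end Frame

/-! ### Integrability of coefficients and change of variables between two charts. -/

section ChartIntegral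

variable {N : ℕ} {H : Type*} [TopologicalSpace H]
  {I : ModelWithCorners ℝ (EuclideanSpace ℝ (Fin N)) H}
  {M : Type*} [TopologicalSpace M] [ChartedSpace H M] [IsManifold I ∞ M] [T2Space M]

theorem evalForm_add (V : ∀ p : M, Fin N → TangentSpace I p) (θ θ' : MaxForm I M ℝ ℝ) (p : M) :
    evalForm V (θ + θ') p = evalForm V θ p + evalForm V θ' p := by
  rw [map_add, Pi.add_apply]

theorem evalForm_smul (V : ∀ p : M, Fin N → TangentSpace I p) (a : SmoothFun I M)
    (θ : MaxForm I M ℝ ℝ) (p : M) : evalForm V (a • θ) p = a p * evalForm V θ p := by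
  rw [map_smul]
  rfl

theorem evalForm_eq_zero_of_notMem_formSupport (V : ∀ p : M, Fin N → TangentSpace I p)
    {θ : MaxForm I M ℝ ℝ} {p : M} (hp : p ∉ formSupport θ) : evalForm V θ p = 0 := by
  by_contra h
  exact hp (subset_closure ⟨V, h⟩)

theorem evalForm_mulForm (V : ∀ p : M, Fin N → TangentSpace I p) (g : C_c(M, ℝ))
    (θ : MaxForm I M ℝ ℝ) (p : M) : evalForm V (mulForm g θ) p = g p * evalForm V θ p := by
  induction θ using TensorProduct.induction_on with
  | zero => simp
  | tmul f T =>
    change valueAt T p (V p) * (g p * f.1 p) = g p * (valueAt T p (V p) * f.1 p)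
    ring
  | add x y hx hy => rw [map_add, evalForm_add, hx, hy, evalForm_add, mul_add]

/-- The coefficient of the form `θ` in the chart `e`. -/
def chartCoeff (e : OpenPartialHomeomorph M H) (θ : MaxForm I M ℝ ℝ)
    (x : EuclideanSpace ℝ (Fin N)) : ℝ :=
  evalForm (coordFrame e) θ ((e.extend I).symm x)

theorem chartIntegral_eq_integral_chartCoeff (e : OpenPartialHomeomorph M H)
    (θ : MaxForm I M ℝ ℝ) : chartIntegral e θ = ∫ x in (e.extend I).target, chartCoeff e θ x := rfl

theorem measurableSet_extend_target {M : Type*} [TopologicalSpace M]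
    (e : OpenPartialHomeomorph M H) : MeasurableSet (e.extend I).target := by
  rw [OpenPartialHomeomorph.extend_target]
  exact (e.open_target.preimage I.continuous_symm).measurableSet.inter
    I.isClosed_range.measurableSet

/-- On a pure tensor the coefficient is a locally integrable function times a continuous one. -/
theorem locallyIntegrableOn_chartCoeff {e : OpenPartialHomeomorph M H}
    (he : e ∈ IsManifold.maximalAtlas I ∞ M) (θ : MaxForm I M ℝ ℝ) :
    LocallyIntegrableOn (chartCoeff e θ) (e.extend I).target volume := by
  induction θ using TensorProduct.induction_on with
  | zero =>
    refine locallyIntegrableOn_zero.congr (Filter.Eventually.of_forall fun x => ?_)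
    simp [chartCoeff]
  | tmul f T =>
    have hc : ContinuousOn (fun x => valueAt T ((e.extend I).symm x)
        (coordFrame e ((e.extend I).symm x))) (e.extend I).target :=
      (continuousOn_valueAt_coordFrame he T).comp e.continuousOn_extend_symm fun x hx => by
        rw [← e.extend_source (I := I)]
        exact (e.extend I).map_target hx
    exact (f.2.1 e he (ContinuousLinearMap.id ℝ ℝ)).continuousOn_smul
      (isLocallyClosed_target e) hc
  | add x y hx hy =>
    refine (hx.add hy).congr (Filter.Eventually.of_forall fun z => ?_)
    exact (evalForm_add _ _ _ _).symm

theorem integrableOn_chartCoeff {e : OpenPartialHomeomorph M H}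
    (he : e ∈ IsManifold.maximalAtlas I ∞ M) {θ : MaxForm I M ℝ ℝ} {K : Set M}
    (hK : IsCompact K) (hKe : K ⊆ e.source) (h0 : ∀ p ∉ K, ∀ V, evalForm V θ p = 0) :
    IntegrableOn (chartCoeff e θ) (e.extend I).target volume := by
  have hKe' : K ⊆ (e.extend I).source := by rwa [e.extend_source]
  have hc : IsCompact (e.extend I '' K) :=
    hK.image_of_continuousOn (e.continuousOn_extend.mono hKe')
  have hsub : e.extend I '' K ⊆ (e.extend I).target :=
    (image_mono hKe').trans (e.extend I).image_source_eq_target.subset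
  refine ((locallyIntegrableOn_chartCoeff he θ).integrableOn_compact_subset hsub
    hc).of_forall_sdiff_eq_zero (measurableSet_extend_target e) fun x hx => h0 _ (fun h => ?_) _
  exact hx.2 ⟨_, h, (e.extend I).right_inv hx.1⟩

/-- Compactness comes from the support of `θ`, and containment in the chart from that of `a`; local
integrability on the intersection then gives integrability. -/
theorem integrableOn_chartCoeff_smul {e : OpenPartialHomeomorph M H}
    (he : e ∈ IsManifold.maximalAtlas I ∞ M) (θ : MaxForm I M ℝ ℝ) {a : SmoothFun I M}
    (ha : tsupport a ⊆ e.source) :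
    IntegrableOn (chartCoeff e (a • θ)) (e.extend I).target volume := by
  refine integrableOn_chartCoeff he ((isCompact_formSupport θ).inter_left (isClosed_tsupport a))
    (inter_subset_left.trans ha) fun p hp V => ?_
  rw [evalForm_smul]
  by_cases h : p ∈ formSupport θ
  · rw [image_eq_zero_of_notMem_tsupport fun h' => hp ⟨h', h⟩, zero_mul]
  · rw [evalForm_eq_zero_of_notMem_formSupport V h, mul_zero]

theorem evalForm_coordFrame_eq_det_mul {e e' : OpenPartialHomeomorph M H}
    (he : e ∈ IsManifold.maximalAtlas I ∞ M) (he' : e' ∈ IsManifold.maximalAtlas I ∞ M)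
    {p : M} (hp : p ∈ e.source) (hp' : p ∈ e'.source) (θ : MaxForm I M ℝ ℝ) :
    evalForm (coordFrame e) θ p =
      (coordChangeDeriv I e e' (e.extend I p)).det * evalForm (coordFrame e') θ p := by
  induction θ using TensorProduct.induction_on with
  | zero => simp
  | tmul f T =>
    have h := alternatingMap_comp_eq_det_mul (valueAlt T p) (frameMap I e' p)
      (coordChangeDeriv I e e' (e.extend I p)).toLinearMap
    have h1 : (fun i => frameMap I e' p ((coordChangeDeriv I e e' (e.extend I p)).toLinearMap
        (EuclideanSpace.single i 1))) = coordFrame e p := by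
      funext i
      rw [← frameMap_single]
      exact (frameMap_eq_comp he he' hp hp' _).symm
    rw [h1] at h
    change valueAt T p (coordFrame e p) * f.1 p = _ * (valueAt T p (coordFrame e' p) * f.1 p)
    rw [← mul_assoc]
    exact congrArg (· * f.1 p) h
  | add x y hx hy => rw [evalForm_add, evalForm_add, hx, hy, mul_add]

omit [IsManifold I ∞ M] [T2Space M] in
-- The Jacobian determinant is the determinant of one coordinate basis in the other, so its sign
-- tells whether the two charts induce the same orientation.
theorem chartSign_mul_det {o : ManifoldOrientation I M} {e e' : OpenPartialHomeomorph M H}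
    (he : e ∈ IsManifold.maximalAtlas I ∞ M) (he' : e' ∈ IsManifold.maximalAtlas I ∞ M)
    (ho : IsPositiveChart o.orient e ∨ IsNegativeChart o.orient e)
    (ho' : IsPositiveChart o.orient e' ∨ IsNegativeChart o.orient e')
    {p : M} (hp : p ∈ e.source) (hp' : p ∈ e'.source) :
    chartSign o e * (coordChangeDeriv I e e' (e.extend I p)).det =
      chartSign o e' * |(coordChangeDeriv I e e' (e.extend I p)).det| := by
  set d := (coordChangeDeriv I e e' (e.extend I p)).det with hd
  have key : ∀ b b' : Module.Basis (Fin N) ℝ (TangentSpace I p),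
      (∀ i, b i = coordFrame e p i) → (∀ i, b' i = coordFrame e' p i) → b'.det b = d := by
    intro b b' hb hb'
    have h := alternatingMap_comp_eq_det_mul b'.det (frameMap I e' p)
      (coordChangeDeriv I e e' (e.extend I p)).toLinearMap
    have h1 : (fun i => frameMap I e' p ((coordChangeDeriv I e e' (e.extend I p)).toLinearMap
        (EuclideanSpace.single i 1))) = b := by
      funext i
      rw [hb, ← frameMap_single]
      exact (frameMap_eq_comp he he' hp hp' _).symm
    have h2 : (fun i => frameMap I e' p (EuclideanSpace.single i 1)) = b' := by
      funext i
      rw [hb', ← frameMap_single]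
    rw [h1, h2, Module.Basis.det_self, mul_one] at h
    exact h
  have same : ∀ b b' : Module.Basis (Fin N) ℝ (TangentSpace I p),
      (∀ i, b i = coordFrame e p i) → (∀ i, b' i = coordFrame e' p i) →
      b.orientation = b'.orientation → d = |d| := by
    intro b b' hb hb' h
    rw [eq_comm, Module.Basis.orientation_eq_iff_det_pos, key b b' hb hb'] at h
    exact (abs_of_pos h).symm
  have diff : ∀ b b' : Module.Basis (Fin N) ℝ (TangentSpace I p),
      (∀ i, b i = coordFrame e p i) → (∀ i, b' i = coordFrame e' p i) →
      b.orientation = -b'.orientation → d = -|d| := by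
    intro b b' hb hb' h
    -- Nonpositivity is enough to compute `|d|`.
    have h1 : ¬ 0 < d := by
      rw [← key b b' hb hb', ← Module.Basis.orientation_eq_iff_det_pos, h]
      exact Module.Ray.ne_neg_self _
    rw [abs_of_nonpos (not_lt.mp h1), neg_neg]
  unfold chartSign
  split_ifs with h1 h2 h2
  · obtain ⟨b, hb, hbo⟩ := h1 p hp
    obtain ⟨b', hb', hbo'⟩ := h2 p hp'
    rw [one_mul, one_mul]
    exact same b b' hb hb' (hbo.trans hbo'.symm)
  · obtain ⟨b, hb, hbo⟩ := h1 p hp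
    obtain ⟨b', hb', hbo'⟩ := (ho'.resolve_left h2) p hp'
    rw [one_mul, neg_one_mul]
    exact diff b b' hb hb' (by rw [hbo, hbo']; exact (neg_neg (o.orient p)).symm)
  · obtain ⟨b, hb, hbo⟩ := (ho.resolve_left h1) p hp
    obtain ⟨b', hb', hbo'⟩ := h2 p hp'
    rw [one_mul, neg_one_mul, neg_eq_iff_eq_neg]
    exact diff b b' hb hb' (by rw [hbo, hbo'])
  · obtain ⟨b, hb, hbo⟩ := (ho.resolve_left h1) p hp
    obtain ⟨b', hb', hbo'⟩ := (ho'.resolve_left h2) p hp'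
    rw [neg_one_mul, neg_one_mul, neg_inj]
    exact same b b' hb hb' (hbo.trans hbo'.symm)

/-- The signed integrals in two oriented charts agree for a form that vanishes outside of both
domains. -/
theorem chartSign_mul_chartIntegral_eq {o : ManifoldOrientation I M}
    {e e' : OpenPartialHomeomorph M H}
    (he : e ∈ IsManifold.maximalAtlas I ∞ M) (he' : e' ∈ IsManifold.maximalAtlas I ∞ M)
    (ho : IsPositiveChart o.orient e ∨ IsNegativeChart o.orient e)
    (ho' : IsPositiveChart o.orient e' ∨ IsNegativeChart o.orient e')
    {θ : MaxForm I M ℝ ℝ} (h0 : ∀ p ∉ e.source, ∀ V, evalForm V θ p = 0)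
    (h0' : ∀ p ∉ e'.source, ∀ V, evalForm V θ p = 0) :
    chartSign o e * chartIntegral e θ = chartSign o e' * chartIntegral e' θ := by
  set c := I.extendCoordChange e e' with hc
  have hmeas : MeasurableSet c.source := by
    rw [hc, I.extendCoordChange_source, I.image_eq]
    exact ((e.symm ≫ₕ e').open_source.preimage I.continuous_symm).measurableSet.inter
      I.isClosed_range.measurableSet
  -- Vanishing outside the other domain reduces both integrals to the overlap.
  have h1 : chartIntegral e θ = ∫ x in c.source, chartCoeff e θ x := by
    refine (setIntegral_eq_of_subset_of_forall_sdiff_eq_zero (measurableSet_extend_target e)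
      (fun x hx => hx.1) fun x hx => h0' _ (fun h => hx.2 ⟨hx.1, ?_⟩) _)
    change _ ∈ (e'.extend I).source
    rwa [e'.extend_source]
  have h2 : chartIntegral e' θ = ∫ x in c '' c.source, chartCoeff e' θ x := by
    rw [c.image_source_eq_target]
    refine (setIntegral_eq_of_subset_of_forall_sdiff_eq_zero (measurableSet_extend_target e')
      (fun x hx => hx.1) fun x hx => h0 _ (fun h => hx.2 ⟨hx.1, ?_⟩) _)
    change _ ∈ (e.extend I).source
    rwa [e.extend_source]
  -- The overlap need not be open in `ℝ^N` when there is a boundary; this formula only needs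
  -- measurability, injectivity and a derivative within the set.
  rw [h1, h2, integral_image_eq_integral_abs_det_fderiv_smul volume hmeas
    (fun x hx => hasFDerivWithinAt_extendCoordChange he he' hx) c.injOn, ← integral_const_mul,
    ← integral_const_mul]
  refine setIntegral_congr_fun hmeas fun x hx => ?_
  have hp : (e.extend I).symm x ∈ e.source := by
    rw [← e.extend_source (I := I)]
    exact (e.extend I).map_target hx.1
  have hp' : (e.extend I).symm x ∈ e'.source := by
    rw [← e'.extend_source (I := I)]
    exact hx.2
  have hx' : e.extend I ((e.extend I).symm x) = x := (e.extend I).right_inv hx.1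
  have hcx : (e'.extend I).symm (c x) = (e.extend I).symm x := (e'.extend I).left_inv hx.2
  have h3 := evalForm_coordFrame_eq_det_mul he he' hp hp' θ
  have h4 := chartSign_mul_det (o := o) he he' ho ho' hp hp'
  rw [hx'] at h3 h4
  simp only [chartCoeff, smul_eq_mul]
  rw [hcx, h3, ← mul_assoc, h4, mul_assoc]

end ChartIntegral

/-! ### Independence of the charts and of the partition of unity. -/

section Independence

variable {N : ℕ} {H : Type*} [TopologicalSpace H]
  {I : ModelWithCorners ℝ (EuclideanSpace ℝ (Fin N)) H}
  {M : Type*} [TopologicalSpace M] [ChartedSpace H M] [IsManifold I ∞ M] [T2Space M]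

variable {o : ManifoldOrientation I M} {S S' : Set M}

theorem OrientedCover.integrableOn (D : OrientedCover o S) (a : Fin D.n) (θ : MaxForm I M ℝ ℝ) :
    IntegrableOn (chartCoeff (D.chart a) (D.pou (some a) • θ)) ((D.chart a).extend I).target
      volume :=
  integrableOn_chartCoeff_smul (D.chart_mem a) θ (D.subordinate (some a))

omit [IsManifold I ∞ M] [T2Space M] in
-- The function of index `none` is supported in the complement of `S`, so it drops out on `S`.
theorem OrientedCover.sum_pou_eq_one (D : OrientedCover o S) {p : M} (hp : p ∈ S) :
    ∑ a, D.pou (some a) p = 1 := by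
  have h := D.pou.sum_eq_one (mem_univ p)
  rw [finsum_eq_sum_of_fintype, Fintype.sum_option,
    image_eq_zero_of_notMem_tsupport fun h => D.subordinate none h hp, zero_add] at h
  exact h

theorem OrientedCover.sum_add (D : OrientedCover o S) (θ θ' : MaxForm I M ℝ ℝ) :
    D.sum (θ + θ') = D.sum θ + D.sum θ' := by
  simp only [OrientedCover.sum]
  rw [← Finset.sum_add_distrib]
  refine Finset.sum_congr rfl fun a _ => ?_
  rw [← mul_add, chartIntegral_eq_integral_chartCoeff, chartIntegral_eq_integral_chartCoeff,
    chartIntegral_eq_integral_chartCoeff, ← integral_add (D.integrableOn a θ) (D.integrableOn a θ')]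
  congr 2
  funext x
  simp only [chartCoeff, smul_add, evalForm_add]

theorem evalForm_real_smul (V : ∀ p : M, Fin N → TangentSpace I p) (c : ℝ)
    (θ : MaxForm I M ℝ ℝ) (p : M) : evalForm V (c • θ) p = c * evalForm V θ p := by
  rw [← algebraMap_smul (SmoothFun I M) c θ, evalForm_smul]
  rfl

theorem OrientedCover.sum_smul (D : OrientedCover o S) (c : ℝ) (θ : MaxForm I M ℝ ℝ) :
    D.sum (c • θ) = c * D.sum θ := by
  simp only [OrientedCover.sum]
  rw [Finset.mul_sum]
  refine Finset.sum_congr rfl fun a _ => ?_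
  rw [mul_left_comm]
  congr 1
  rw [chartIntegral_eq_integral_chartCoeff, chartIntegral_eq_integral_chartCoeff,
    ← integral_const_mul]
  congr 1
  funext x
  simp only [chartCoeff, evalForm_smul, evalForm_real_smul]
  ring

/-- The second partition sums to `1` on the support of `θ`, and elsewhere both integrands vanish. -/
theorem OrientedCover.chartIntegral_smul_eq_sum (D : OrientedCover o S) (D' : OrientedCover o S')
    {θ : MaxForm I M ℝ ℝ} (h : formSupport θ ⊆ S') (a : Fin D.n) :
    chartIntegral (D.chart a) (D.pou (some a) • θ) =
      ∑ b, chartIntegral (D.chart a) (D.pou (some a) • D'.pou (some b) • θ) := by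
  simp only [chartIntegral_eq_integral_chartCoeff]
  rw [← integral_finsetSum _ fun b _ => D.integrableOn a _]
  congr 1
  funext x
  simp only [chartCoeff, evalForm_smul]
  set p := ((D.chart a).extend I).symm x
  rw [← Finset.mul_sum, ← Finset.sum_mul]
  by_cases hp : p ∈ formSupport θ
  · rw [D'.sum_pou_eq_one (h hp), one_mul]
  · rw [evalForm_eq_zero_of_notMem_formSupport _ hp, mul_zero, mul_zero, mul_zero]

/-- The sum over an oriented cover of a set that contains the support does not depend on the
cover. -/
theorem OrientedCover.sum_eq_sum (D : OrientedCover o S) (D' : OrientedCover o S')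
    {θ : MaxForm I M ℝ ℝ} (h : formSupport θ ⊆ S) (h' : formSupport θ ⊆ S') :
    D.sum θ = D'.sum θ := by
  simp only [OrientedCover.sum]
  -- Both sides become double sums over pairs of charts, to be compared term by term.
  simp_rw [D.chartIntegral_smul_eq_sum D' h', D'.chartIntegral_smul_eq_sum D h, Finset.mul_sum]
  rw [Finset.sum_comm]
  refine Finset.sum_congr rfl fun b _ => Finset.sum_congr rfl fun a _ => ?_
  rw [smul_comm (D'.pou (some b)) (D.pou (some a)) θ]
  refine chartSign_mul_chartIntegral_eq (D.chart_mem a) (D'.chart_mem b) (D.oriented a)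
    (D'.oriented b) (fun p hp V => ?_) fun p hp V => ?_
  · rw [evalForm_smul, image_eq_zero_of_notMem_tsupport fun h => hp (D.subordinate (some a) h),
      zero_mul]
  · rw [evalForm_smul, evalForm_smul,
      image_eq_zero_of_notMem_tsupport fun h => hp (D'.subordinate (some b) h), zero_mul, mul_zero]

end Independence

/-! ### Linearity and continuity of the real integral. -/

section RealIntegral

variable {N : ℕ} {H : Type*} [TopologicalSpace H]
  {I : ModelWithCorners ℝ (EuclideanSpace ℝ (Fin N)) H}
  {M : Type*} [TopologicalSpace M] [ChartedSpace H M] [IsManifold I ∞ M] [T2Space M]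
  [SigmaCompactSpace M] (o : ManifoldOrientation I M)

variable {o} in
-- Since `S` may exceed the support, one cover can serve several forms at once.
theorem realIntegral_eq_sum {S : Set M} (D : OrientedCover o S) {θ : MaxForm I M ℝ ℝ}
    (h : formSupport θ ⊆ S) : realIntegral o θ = D.sum θ :=
  OrientedCover.sum_eq_sum _ D subset_rfl h

omit [SigmaCompactSpace M] in
theorem formSupport_subset_of_imp {θ θ' : MaxForm I M ℝ ℝ}
    (h : ∀ V p, evalForm V θ p = 0 → evalForm V θ' p = 0) : formSupport θ' ⊆ formSupport θ :=
  closure_mono fun p ⟨V, hV⟩ => ⟨V, fun h' => hV (h V p h')⟩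

omit [SigmaCompactSpace M] in
theorem formSupport_add_subset (θ θ' : MaxForm I M ℝ ℝ) :
    formSupport (θ + θ') ⊆ formSupport θ ∪ formSupport θ' := by
  refine closure_minimal ?_ (isClosed_closure.union isClosed_closure)
  rintro p ⟨V, hV⟩
  by_contra hp
  rw [mem_union, not_or] at hp
  refine hV ?_
  rw [evalForm_add, evalForm_eq_zero_of_notMem_formSupport V hp.1,
    evalForm_eq_zero_of_notMem_formSupport V hp.2, add_zero]

/-- The integral of real valued maximal forms, as a linear functional. -/
def realIntegralₗ : MaxForm I M ℝ ℝ →ₗ[ℝ] ℝ where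
  toFun := realIntegral o
  map_add' θ θ' := by
    obtain ⟨D⟩ := nonempty_orientedCover o
      ((isCompact_formSupport θ).union (isCompact_formSupport θ'))
    rw [realIntegral_eq_sum D (formSupport_add_subset θ θ'),
      realIntegral_eq_sum D subset_union_left, realIntegral_eq_sum D subset_union_right, D.sum_add]
  map_smul' c θ := by
    obtain ⟨D⟩ := nonempty_orientedCover o (isCompact_formSupport θ)
    rw [realIntegral_eq_sum D (formSupport_subset_of_imp fun V p h => by
        rw [evalForm_real_smul, h, mul_zero]),
      realIntegral_eq_sum D subset_rfl, D.sum_smul]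
    rfl

theorem realIntegralₗ_apply (θ : MaxForm I M ℝ ℝ) : realIntegralₗ o θ = realIntegral o θ := rfl

/-- The linear functional `g ↦ ∫ g · θ` is continuous for the uniform norm. -/
theorem exists_abs_realIntegral_mulForm_le (θ : MaxForm I M ℝ ℝ) :
    ∃ C : ℝ, ∀ (g : C_c(M, ℝ)) (ε : ℝ), (∀ p, |g p| ≤ ε) →
      |realIntegral o (mulForm g θ)| ≤ C * ε := by
  obtain ⟨D⟩ := nonempty_orientedCover o (isCompact_formSupport θ)
  -- The constant does not depend on `g`, since the support of `g · θ` lies in that of `θ` and the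
  -- same cover computes every integral.
  refine ⟨∑ a, |chartSign o (D.chart a)| * ∫ x in ((D.chart a).extend I).target,
    |chartCoeff (D.chart a) (D.pou (some a) • θ) x|, fun g ε hg => ?_⟩
  rw [realIntegral_eq_sum D (formSupport_subset_of_imp fun V p h => by
    rw [evalForm_mulForm, h, mul_zero]), OrientedCover.sum, Finset.sum_mul]
  refine (Finset.abs_sum_le_sum_abs _ _).trans (Finset.sum_le_sum fun a _ => ?_)
  rw [abs_mul, mul_assoc]
  refine mul_le_mul_of_nonneg_left ?_ (abs_nonneg _)
  rw [chartIntegral_eq_integral_chartCoeff, ← integral_mul_const, ← Real.norm_eq_abs]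
  refine norm_integral_le_of_norm_le ((D.integrableOn a θ).norm.mul_const ε)
    (Filter.Eventually.of_forall fun x => ?_)
  simp only [chartCoeff, evalForm_smul, evalForm_mulForm, Real.norm_eq_abs]
  rw [mul_left_comm, abs_mul, mul_comm]
  exact mul_le_mul_of_nonneg_left (hg _) (abs_nonneg _)

end RealIntegral

/-! ### The weak integral as an element of the algebraic dual. -/

section ScalarIntegral

variable {N : ℕ} {H : Type*} [TopologicalSpace H]
  {I : ModelWithCorners ℝ (EuclideanSpace ℝ (Fin N)) H}
  {M : Type*} [TopologicalSpace M] [ChartedSpace H M] [IsManifold I ∞ M]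
  {𝕜 : Type*} [RCLike 𝕜] {G : Type*} [AddCommGroup G] [Module 𝕜 G] [TopologicalSpace G]
  [Module ℝ G] [IsScalarTower ℝ 𝕜 G]

theorem pushForm_add (ψ χ : StrongDual 𝕜 G) (η : MaxForm I M 𝕜 G) :
    pushForm (ψ + χ) η = pushForm ψ η + pushForm χ η := by
  have h : pushFun (I := I) (M := M) (ψ + χ) = pushFun ψ + pushFun χ := rfl
  rw [pushForm, h, TensorProduct.map_add_left]
  rfl

/-- The scalar integral is built from real and imaginary parts, so its compatibility with scalars of
`𝕜` has to be recovered from the rule for the real part of a product. -/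
theorem reForm_pushForm_smul (c : 𝕜) (ψ : StrongDual 𝕜 G) (η : MaxForm I M 𝕜 G) :
    reForm (pushForm (c • ψ) η) =
      RCLike.re c • reForm (pushForm ψ η) - RCLike.im c • imForm (pushForm ψ η) := by
  induction η using TensorProduct.induction_on with
  | zero => simp
  | tmul f T =>
    have h : partFun RCLike.reCLM (pushFun (c • ψ) f) =
        RCLike.re c • partFun RCLike.reCLM (pushFun ψ f) -
          RCLike.im c • partFun RCLike.imCLM (pushFun ψ f) :=
      Subtype.ext <| funext fun p => RCLike.mul_re c (ψ (f.1 p))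
    change partFun RCLike.reCLM (pushFun (c • ψ) f) ⊗ₜ[SmoothFun I M] T = _
    rw [h, TensorProduct.sub_tmul]
    rfl
  | add x y hx hy =>
    simp only [map_add, smul_add, hx, hy]
    abel

theorem imForm_pushForm_smul (c : 𝕜) (ψ : StrongDual 𝕜 G) (η : MaxForm I M 𝕜 G) :
    imForm (pushForm (c • ψ) η) =
      RCLike.re c • imForm (pushForm ψ η) + RCLike.im c • reForm (pushForm ψ η) := by
  induction η using TensorProduct.induction_on with
  | zero => simp
  | tmul f T =>
    have h : partFun RCLike.imCLM (pushFun (c • ψ) f) =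
        RCLike.re c • partFun RCLike.imCLM (pushFun ψ f) +
          RCLike.im c • partFun RCLike.reCLM (pushFun ψ f) :=
      Subtype.ext <| funext fun p => RCLike.mul_im c (ψ (f.1 p))
    change partFun RCLike.imCLM (pushFun (c • ψ) f) ⊗ₜ[SmoothFun I M] T = _
    rw [h, TensorProduct.add_tmul]
    rfl
  | add x y hx hy =>
    simp only [map_add, smul_add, hx, hy]
    abel

theorem mulForm_add_left (g g' : C_c(M, ℝ)) (η : MaxForm I M 𝕜 G) :
    mulForm (g + g') η = mulForm g η + mulForm g' η := by
  have h : mulFun (I := I) (𝕜 := 𝕜) (G := G) (g + g') = mulFun g + mulFun g' :=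
    LinearMap.ext fun f => Subtype.ext <| funext fun p => add_smul (g p) (g' p) (f.1 p)
  rw [mulForm, h, TensorProduct.map_add_left]
  rfl

theorem mulForm_smul_left (c : ℝ) (g : C_c(M, ℝ)) (η : MaxForm I M 𝕜 G) :
    mulForm (c • g) η = c • mulForm g η := by
  induction η using TensorProduct.induction_on with
  | zero => simp
  | tmul f T =>
    have h : mulFun (c • g) f = c • mulFun g f :=
      Subtype.ext <| funext fun p => mul_smul c (g p) (f.1 p)
    change mulFun (c • g) f ⊗ₜ[SmoothFun I M] T = _
    rw [h]
    rfl
  | add x y hx hy => rw [map_add, hx, hy, map_add, smul_add]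

theorem pushForm_mulForm (ψ : StrongDual 𝕜 G) (g : C_c(M, ℝ)) (η : MaxForm I M 𝕜 G) :
    pushForm ψ (mulForm g η) = mulForm g (pushForm ψ η) := by
  induction η using TensorProduct.induction_on with
  | zero => simp
  | tmul f T =>
    have h : pushFun ψ (mulFun g f) = mulFun g (pushFun ψ f) :=
      Subtype.ext <| funext fun p => LinearMap.map_smul_of_tower ψ.toLinearMap (g p) (f.1 p)
    exact congrArg (· ⊗ₜ[SmoothFun I M] T) h
  | add x y hx hy => simp only [map_add, hx, hy]

theorem reForm_mulForm (g : C_c(M, ℝ)) (θ : MaxForm I M 𝕜 𝕜) :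
    reForm (mulForm g θ) = mulForm g (reForm θ) := by
  induction θ using TensorProduct.induction_on with
  | zero => simp
  | tmul f T =>
    have h : partFun RCLike.reCLM (mulFun g f) = mulFun g (partFun RCLike.reCLM f) :=
      Subtype.ext <| funext fun p => map_smul (RCLike.reCLM (K := 𝕜)) (g p) (f.1 p)
    exact congrArg (· ⊗ₜ[SmoothFun I M] T) h
  | add x y hx hy => simp only [map_add, hx, hy]

theorem imForm_mulForm (g : C_c(M, ℝ)) (θ : MaxForm I M 𝕜 𝕜) :
    imForm (mulForm g θ) = mulForm g (imForm θ) := by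
  induction θ using TensorProduct.induction_on with
  | zero => simp
  | tmul f T =>
    have h : partFun RCLike.imCLM (mulFun g f) = mulFun g (partFun RCLike.imCLM f) :=
      Subtype.ext <| funext fun p => map_smul (RCLike.imCLM (K := 𝕜)) (g p) (f.1 p)
    exact congrArg (· ⊗ₜ[SmoothFun I M] T) h
  | add x y hx hy => simp only [map_add, hx, hy]

variable [T2Space M] [SigmaCompactSpace M] (o : ManifoldOrientation I M)

/-- The integral of `𝕜`-valued maximal forms, as a real linear map. -/
def scalarIntegralₗ : MaxForm I M 𝕜 𝕜 →ₗ[ℝ] 𝕜 :=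
  (Algebra.linearMap ℝ 𝕜 ∘ₗ realIntegralₗ o ∘ₗ reForm.restrictScalars ℝ) +
    LinearMap.mulLeft ℝ (RCLike.I : 𝕜) ∘ₗ
      (Algebra.linearMap ℝ 𝕜 ∘ₗ realIntegralₗ o ∘ₗ imForm.restrictScalars ℝ)

theorem weakIntegral_eq (η : MaxForm I M 𝕜 G) (ψ : StrongDual 𝕜 G) :
    weakIntegral o η ψ = scalarIntegralₗ o (pushForm ψ η) := rfl

theorem weakIntegral_smul (c : 𝕜) (η : MaxForm I M 𝕜 G) (ψ : StrongDual 𝕜 G) :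
    weakIntegral o η (c • ψ) = c * weakIntegral o η ψ := by
  simp only [weakIntegral, scalarIntegral, ← realIntegralₗ_apply]
  rw [reForm_pushForm_smul, imForm_pushForm_smul]
  simp only [map_add, map_sub, map_smul, smul_eq_mul]
  set r := realIntegralₗ o (reForm (pushForm ψ η))
  set s := realIntegralₗ o (imForm (pushForm ψ η))
  push_cast
  conv_rhs => rw [← RCLike.re_add_im c]
  -- Either `I = 0`, which is the real case and forces `im c = 0`, or `I * I = -1`.
  rcases RCLike.I_mul_I_ax (K := 𝕜) with h | h
  · have hc : RCLike.im c = 0 := by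
      rw [← RCLike.mul_im_I_ax c, h, map_zero, mul_zero]
    simp [h, hc]
  · linear_combination (-(RCLike.im c : 𝕜) * (s : 𝕜)) * h

/-- The weak integral, as a real linear map with values in `(G')^*`. -/
def weakIntegralₗ : MaxForm I M 𝕜 G →ₗ[ℝ] GStar 𝕜 G where
  toFun η :=
    { toFun := weakIntegral o η
      map_add' := fun ψ χ => by simp only [weakIntegral_eq, pushForm_add, map_add]
      map_smul' := fun c ψ => weakIntegral_smul o c η ψ }
  map_add' η η' := LinearMap.ext fun ψ => by
    change weakIntegral o (η + η') ψ = weakIntegral o η ψ + weakIntegral o η' ψ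
    simp only [weakIntegral_eq, map_add]
  map_smul' c η := LinearMap.ext fun ψ => by
    change weakIntegral o (c • η) ψ = c • weakIntegral o η ψ
    rw [weakIntegral_eq, weakIntegral_eq, ← map_smul, LinearMap.map_smul_of_tower]

theorem exists_norm_weakIntegral_mulForm_le (η : MaxForm I M 𝕜 G) (ψ : StrongDual 𝕜 G) :
    ∃ C : ℝ, ∀ (g : C_c(M, ℝ)) (ε : ℝ), (∀ p, |g p| ≤ ε) →
      ‖weakIntegral o (mulForm g η) ψ‖ ≤ C * ε := by
  obtain ⟨C, hC⟩ := exists_abs_realIntegral_mulForm_le o (reForm (pushForm ψ η))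
  obtain ⟨C', hC'⟩ := exists_abs_realIntegral_mulForm_le o (imForm (pushForm ψ η))
  refine ⟨C + C', fun g ε hg => ?_⟩
  rw [weakIntegral, scalarIntegral, pushForm_mulForm, reForm_mulForm, imForm_mulForm, add_mul]
  refine (norm_add_le _ _).trans (add_le_add ?_ ?_)
  · rw [RCLike.norm_ofReal]
    exact hC g ε hg
  · rw [norm_mul, RCLike.norm_ofReal]
    have hI : ‖(RCLike.I : 𝕜)‖ ≤ 1 := by
      by_cases h : (RCLike.I : 𝕜) = 0
      · simp [h]
      · exact (RCLike.norm_I_of_ne_zero h).le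
    exact (mul_le_of_le_one_left (abs_nonneg _) hI).trans (hC' g ε hg)

end ScalarIntegral

/-! ### Continuity criteria for the inductive limit topology. -/

section Measures

variable {X : Type*} [TopologicalSpace X]

/-- A linear map on `ℋ(X)` is continuous if its restrictions to the spaces `ℋ(X, K)` are. -/
theorem continuous_of_continuous_supported {E : Type*} [AddCommGroup E] [Module ℝ E]
    [TopologicalSpace E] [IsTopologicalAddGroup E] [ContinuousSMul ℝ E] [LocallyConvexSpace ℝ E]
    (L : C_c(X, ℝ) →ₗ[ℝ] E)
    (h : ∀ K : TopologicalSpace.Compacts X,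
      @Continuous _ _ (supportedTopology X K) _ fun f : {f : C_c(X, ℝ) // tsupport f ⊆ K} =>
        L f.1) : Continuous L := by
  rw [continuous_iff_le_induced]
  -- The topology induced by `L` is itself one of the locally convex topologies whose infimum
  -- defines that of `ℋ(X)`.
  refine sInf_le ⟨fun K => ?_, topologicalAddGroup_induced L, continuousSMul_induced L,
    LocallyConvexSpace.induced L⟩
  exact continuous_induced_rng.mpr (h K)

theorem continuous_of_norm_le {E : Type*} [NormedAddCommGroup E] [NormedSpace ℝ E]
    (L : C_c(X, ℝ) →ₗ[ℝ] E) (C : ℝ)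
    (h : ∀ (g : C_c(X, ℝ)) (ε : ℝ), (∀ p, |g p| ≤ ε) → ‖L g‖ ≤ C * ε) : Continuous L := by
  refine continuous_of_continuous_supported L fun K => ?_
  let _ : TopologicalSpace {f : C_c(X, ℝ) // tsupport f ⊆ K} := supportedTopology X K
  refine continuous_iff_continuousAt.mpr fun f => Metric.tendsto_nhds.mpr fun δ hδ => ?_
  have hu : TendstoUniformly (fun (f : {f : C_c(X, ℝ) // tsupport f ⊆ K}) => (f.1 : X → ℝ))
      f.1 (nhds f) :=
    UniformFun.tendsto_iff_tendstoUniformly.mp (continuous_induced_dom.tendsto f)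
  -- The denominator stays positive whatever the sign of `C`, and `C * (δ / (|C| + 1)) < δ`.
  have hε : 0 < δ / (|C| + 1) := by positivity
  filter_upwards [Metric.tendstoUniformly_iff.mp hu _ hε] with f' hf'
  rw [dist_eq_norm, ← map_sub]
  refine (h (f'.1 - f.1) (δ / (|C| + 1)) fun p => ?_).trans_lt ?_
  · have := (hf' p).le
    rwa [dist_comm, Real.dist_eq] at this
  · rw [mul_div_assoc', div_lt_iff₀ (by positivity)]
    nlinarith [le_abs_self C]

end Measures

/-! ### The measure of a form, existence and uniqueness. -/

section VectorMeasure

variable {N : ℕ} {H : Type*} [TopologicalSpace H]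
  {I : ModelWithCorners ℝ (EuclideanSpace ℝ (Fin N)) H}
  {M : Type*} [TopologicalSpace M] [ChartedSpace H M] [IsManifold I ∞ M]
  [T2Space M] [SigmaCompactSpace M]
  {𝕜 : Type*} [RCLike 𝕜] {G : Type*} [AddCommGroup G] [Module 𝕜 G] [TopologicalSpace G]
  [Module ℝ G] [IsScalarTower ℝ 𝕜 G] (o : ManifoldOrientation I M)

/-- The vector measure `g ↦ ∫ g · η` associated with the form `η`. -/
def vectorMeasure (η : MaxForm I M 𝕜 G) : Meas M (GStar 𝕜 G) where
  toFun g := weakIntegralₗ o (mulForm g η)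
  map_add' g g' := by rw [mulForm_add_left, map_add]
  map_smul' c g := by rw [mulForm_smul_left, map_smul]; rfl
  cont := by
    -- In the weak topology continuity is tested at each `ψ` separately, so the bound may depend on
    -- `ψ`.
    refine WeakBilin.continuous_of_continuous_eval _ fun ψ => ?_
    obtain ⟨C, hC⟩ := exists_norm_weakIntegral_mulForm_le o η ψ
    exact continuous_of_norm_le
      { toFun := fun g => weakIntegral o (mulForm g η) ψ
        map_add' := fun g g' => by simp only [weakIntegral_eq, mulForm_add_left, map_add]
        map_smul' := fun c g => by
          rw [mulForm_smul_left, weakIntegral_eq, weakIntegral_eq, RingHom.id_apply,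
            LinearMap.map_smul_of_tower (pushForm ψ), map_smul] } C hC

theorem eval_vectorMeasure (η : MaxForm I M 𝕜 G) (g : C_c(M, ℝ)) :
    GStar.eval (vectorMeasure o η g) = weakIntegral o (mulForm g η) := rfl

/-- The vector measure associated with a form, as a linear function of the form. -/
def vectorMeasureₗ : MaxForm I M 𝕜 G →ₗ[ℝ] Meas M (GStar 𝕜 G) where
  toFun := vectorMeasure o
  map_add' η η' := ContinuousLinearMap.ext fun g => by
    change weakIntegralₗ o (mulForm g (η + η')) = _
    rw [map_add, map_add]
    rfl
  map_smul' c η := ContinuousLinearMap.ext fun g => by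
    change weakIntegralₗ o (mulForm g (c • η)) = _
    rw [LinearMap.map_smul_of_tower, map_smul]
    rfl

end VectorMeasure

end IntegrableForm
end

open IntegrableForm in
theorem mainTheorem2
    {𝕜 : Type*} [RCLike 𝕜]
    {G : Type*} [AddCommGroup G] [Module 𝕜 G] [Module ℝ G] [IsScalarTower ℝ 𝕜 G]
    [TopologicalSpace G] [IsTopologicalAddGroup G] [ContinuousSMul 𝕜 G]
    [LocallyConvexSpace ℝ G] [T2Space G]
    {N : ℕ} [NeZero N] {H : Type*} [TopologicalSpace H]
    (I : ModelWithCorners ℝ (EuclideanSpace ℝ (Fin N)) H)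
    {M : Type*} [TopologicalSpace M] [ChartedSpace H M] [IsManifold I ∞ M]
    [T2Space M] [SigmaCompactSpace M] (o : ManifoldOrientation I M) :
    ∃! m : MaxForm I M 𝕜 G →ₗ[ℝ] Meas M (GStar 𝕜 G),
      ∀ (η : MaxForm I M 𝕜 G) (g : C_c(M, ℝ)),
        GStar.eval (m η g) = weakIntegral o (mulForm g η) := by
  refine ⟨vectorMeasureₗ o, fun η g => eval_vectorMeasure o η g, fun m hm => ?_⟩
  refine LinearMap.ext fun η => ContinuousLinearMap.ext fun g => LinearMap.ext fun ψ => ?_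
  exact congrFun (hm η g) ψ
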